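/- Let $X$ be a set, $\mathcal R$ a set of labels and $w:\mathcal R\to F(X)$ a (not necessarily injective) function into the free group on $X$. Let $G$ be a group with presentation $\langle X\mid w(\mathcal R)\rangle$, that is, let $\theta:F(X)\to G$ be a surjective homomorphism whose kernel is the normal closure of $w(\mathcal R)$. (A set of relators $R\subseteq F(X)$ is the case $\mathcal R=R$, $w$ the inclusion.) Put $Y=\mathcal R\times F(X)$. A $Y$-sequence is an element $(r_1,u_1)^{\varepsilon_1}\cdots(r_n,u_n)^{\varepsilon_n}$ ($\varepsilon_i=\pm1$) of the free monoid $(Y^+\sqcup Y^-)^*$; $\lambda$ is the empty sequence. $F(X)$ acts on $Y$-sequences on the right through $(r,u)^x=(r,ux)$, and $\delta:(Y^+\sqcup Y^-)^*\to F(X)$ is the monoid morphism with $\delta((r,u)^\varepsilon)=u^{-1}w(r)^\varepsilon u$. An identity $Y$-sequence is a $Y$-sequence $\iota$ with $\delta(\iota)=1$. Peiffer equivalence is the equivalence relation on $Y$-sequences generated by replacing, inside a sequence, the left side of one of the rules $$y^-z^+y^+\to (z^+)^{\delta(y^+)},\quad y^+z^-y^-\to (z^-)^{\delta(y^-)},\quad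 y^-y^+\to\lambda,\quad y^+y^-\to\lambda\qquad(y,z\in Y)$$ by its right side. Let $\mathbb ZG[\mathcal R]$ be the free right $\mathbb ZG$-module on $\mathcal R$, let $\alpha:(Y^+\sqcup Y^-)^*\to\mathbb ZG[\mathcal R]$ be the map with $\alpha((r,u)^\varepsilon)=r\,(\theta(u)\varepsilon)$, $\alpha(\lambda)=0$ and $\alpha(ab)=\alpha(a)+\alpha(b)$, and write $\langle m\rangle$ for the right $\mathbb ZG$-submodule generated by $m$. (1) An identity $Y$-sequence $\iota$ is Peiffer equivalent to $\lambda$ if and only if $\alpha(\iota)=0$. (2) Consequently, deciding Peiffer equivalence of identity $Y$-sequences reduces to the submodule problem (given $a,b\in\mathbb ZG[\mathcal R]$, is $\langle a\rangle=\langle b\rangle$?): for identity $Y$-sequences $\iota_1,\iota_2$, the sequences $\iota_1$ and $\iota_2$ are Peiffer equivalent if and only if $\alpha(\iota_1)=\alpha(\iota_2)$, equivalently if and only if $\langle\alpha(\iota_1)-\alpha(\iota_2)\rangle=\langle 0\rangle$; and if $\iota_1$ and $\iota_2$ are Peiffer equivalent, then $\langle\alpha(\iota_1)\rangle=\langle\alpha(\iota_2)\rangle$.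 -/

import Mathlib

/-! Throughout, `X` is the set of generators, `L` is the set of labels of the relators and
`w : L → FreeGroup X` sends a label to its relator (`w` need not be injective; for a set of relators
`R ⊆ FreeGroup X` take `w = Subtype.val`). -/

namespace PeifferSeq

/-- The set `Y` of pairs `(ρ, u)` of a relator label and an element of the free group. -/
abbrev Y (X L : Type*) := L × FreeGroup X

/-- The free monoid on `Y⁺ ⊔ Y⁻`: its elements are the `Y`-sequences. The letter `y^ε` is the pair
`(y, ε)` with `ε = 1` or `ε = -1`. -/
abbrev YSeq (X L : Type*) := FreeMonoid (Y X L × ℤˣ)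

variable {X L G : Type*} [Group G]

/-- The one-letter sequence `y^ε`. -/
def letter (y : Y X L) (ε : ℤˣ) : YSeq X L := FreeMonoid.of (y, ε)

/-- The right action of the free group on `Y`-sequences, `a ↦ a^x`, induced by
`(ρ, u)^x = (ρ, u x)`. -/
def act (x : FreeGroup X) : YSeq X L →* YSeq X L :=
  FreeMonoid.map fun t => ((t.1.1, t.1.2 * x), t.2)

/-- The monoid morphism `δ` with `δ((ρ, u)^ε) = u⁻¹ (w ρ)^ε u`. -/
def delta (w : L → FreeGroup X) : YSeq X L →* FreeGroup X :=
  FreeMonoid.lift fun t => t.1.2⁻¹ * w t.1.1 ^ (t.2 : ℤ) * t.1.2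

/-- An identity `Y`-sequence is one whose image under `δ` is the identity. -/
def IsIdentitySeq (w : L → FreeGroup X) (a : YSeq X L) : Prop := delta w a = 1

/-- The set `R_P` of rewriting rules. -/
inductive Rule (w : L → FreeGroup X) : YSeq X L → YSeq X L → Prop
  | conj_pos (y z : Y X L) :
      Rule w (letter y (-1) * letter z 1 * letter y 1) (act (delta w (letter y 1)) (letter z 1))
  | conj_neg (y z : Y X L) :
      Rule w (letter y 1 * letter z (-1) * letter y (-1))
        (act (delta w (letter y (-1))) (letter z (-1)))
  | neg_pos (y : Y X L) : Rule w (letter y (-1) * letter y 1) 1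
  | pos_neg (y : Y X L) : Rule w (letter y 1 * letter y (-1)) 1

/-- The reduction relation generated by `R_P`: apply one rule inside a sequence. -/
def Step (w : L → FreeGroup X) (a b : YSeq X L) : Prop :=
  ∃ p q l r : YSeq X L, Rule w l r ∧ a = p * l * q ∧ b = p * r * q

/-- Peiffer equivalence: the equivalence relation generated by the reduction relation. -/
def PeifferEquiv (w : L → FreeGroup X) : YSeq X L → YSeq X L → Prop :=
  Relation.EqvGen (Step w)

/-- The free right `ℤG`-module on `L`. The right `ℤG`-action is the `(ℤG)ᵐᵒᵖ`-module structure. -/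
abbrev FreeRightMod (L G : Type*) := L →₀ MonoidAlgebra ℤ G

/-- The map `α` with `α((r, u)^ε) = r (θ u) ε`, sending the empty sequence to `0` and a product of
sequences to the sum of their images. -/
noncomputable def alpha (θ : FreeGroup X →* G) (a : YSeq X L) : FreeRightMod L G :=
  (a.toList.map fun t =>
    Finsupp.single t.1.1 (MonoidAlgebra.single (θ t.1.2) (t.2 : ℤ))).sum

/-- The right `ℤG`-submodule generated by one element. -/
noncomputable def cyclicSub (m : FreeRightMod L G) :
    Submodule (MonoidAlgebra ℤ G)ᵐᵒᵖ (FreeRightMod L G) :=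
  Submodule.span (MonoidAlgebra ℤ G)ᵐᵒᵖ {m}

end PeifferSeq

/-!
Peiffer equivalence is the congruence on `Y`-sequences generated by the rules, and the quotient
monoid `H` is a group: the free crossed module of the presentation. The rules say that conjugating
a generator `[(ρ, u)]` of `H` by an element `h` gives `[(ρ, u * δ h)]`, so every `h` with `δ h = 1`
is central (`ker_boundary_le_center`). The image of `δ` is a subgroup of a free group, hence free by
Nielsen–Schreier, so `δ` splits over its image and `H` is the direct product of the central
subgroup `ker δ` and a copy of the image. Commutators in `H` therefore come from the second factor,
and `ker δ` meets the commutator subgroup trivially (`ker_inf_commutator_eq_bot`).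

The image of `δ` is the normal closure of the relators, that is, the kernel of `θ`. Two generators
`(ρ, u)`, `(ρ, v)` with `θ u = θ v` are thus conjugate in `H`, so the class of `(ρ, u)` in the
abelianization of `H` depends only on `ρ` and `θ u`. This gives an additive map from the free
`ℤG`-module to the abelianization that takes `α a` to the class of `a` (`toAbelianization_alpha`).
An identity sequence `a` with `α a = 0` hence represents an element of `ker δ` in the commutator
subgroup, so it is trivial in `H`.
-/

/-! ### Central extensions of free groups -/

/-- A central extension of a free group splits as a direct product, so its kernel contains no
nontrivial product of commutators. Surjectivity is not needed: the image of `f` is again free. -/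
theorem MonoidHom.ker_inf_commutator_eq_bot {H F : Type*} [Group H] [Group F] [IsFreeGroup F]
    (f : H →* F) (hf : f.ker ≤ Subgroup.center H) : f.ker ⊓ commutator H = ⊥ := by
  choose s₀ hs₀ using f.rangeRestrict_surjective
  let s : f.range →* H := IsFreeGroup.lift fun i => s₀ (IsFreeGroup.of i)
  have hs : ∀ n, f.rangeRestrict (s n) = n := by
    have : f.rangeRestrict.comp s = MonoidHom.id _ :=
      IsFreeGroup.ext_hom fun i => by simp [s, hs₀]
    exact fun n => DFunLike.congr_fun this n
  have hker : ∀ h, h * (s (f.rangeRestrict h))⁻¹ ∈ f.ker := fun h => by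
    rw [← f.ker_rangeRestrict, MonoidHom.mem_ker, map_mul, map_inv, hs, mul_inv_cancel]
  -- The projection of `H` onto the central factor.
  let c : H →* Subgroup.center H := MonoidHom.mk' (fun h => ⟨_, hf (hker h)⟩) fun h k => by
    ext
    have := Subgroup.mem_center_iff.1 (hf (hker k)) (s (f.rangeRestrict h))⁻¹
    simp only [map_mul, mul_inv_rev, Subgroup.coe_mul, mul_assoc] at this ⊢
    rw [this]
  refine (Subgroup.eq_bot_iff_forall _).2 fun k hk => ?_
  have hc : commutator H ≤ c.ker := Subgroup.commutator_le.2 fun x _ y _ => by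
    rw [MonoidHom.mem_ker, map_commutatorElement, commutatorElement_eq_one_iff_mul_comm]
    exact Subtype.ext (Subgroup.mem_center_iff.1 (c y).2 _)
  have h1 : c k = 1 := hc hk.2
  have h2 : f.rangeRestrict k = 1 := by
    rw [← MonoidHom.mem_ker, f.ker_rangeRestrict]; exact hk.1
  simpa [c, h2] using congrArg Subtype.val h1

namespace PeifferSeq

variable {X L G : Type*} [Group G]

/-! ### The group of `Y`-sequences modulo Peiffer equivalence -/

theorem peifferEquiv_iff_conGen {w : L → FreeGroup X} {a b : YSeq X L} :
    PeifferEquiv w a b ↔ conGen (Rule w) a b := by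
  constructor
  · intro h
    induction h with
    | rel x y h =>
      obtain ⟨p, q, l, r, h, rfl, rfl⟩ := h
      exact (conGen _).mul ((conGen _).mul ((conGen _).refl p) (.of _ _ h)) ((conGen _).refl q)
    | refl x => exact (conGen _).refl x
    | symm x y _ ih => exact (conGen _).symm ih
    | trans x y z _ _ ih₁ ih₂ => exact (conGen _).trans ih₁ ih₂
  · have hmul : ∀ p q {x y : YSeq X L}, PeifferEquiv w x y →
        PeifferEquiv w (p * x * q) (p * y * q) := by
      intro p q x y h
      induction h with
      | rel x y h =>
        obtain ⟨p', q', l, r, h, rfl, rfl⟩ := h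
        exact .rel _ _ ⟨p * p', q' * q, l, r, h, by simp only [mul_assoc], by simp only [mul_assoc]⟩
      | refl x => exact .refl _
      | symm x y _ ih => exact ih.symm
      | trans x y z _ _ ih₁ ih₂ => exact ih₁.trans _ _ _ ih₂
    intro h
    induction h with
    | of x y h => exact .rel _ _ ⟨1, 1, x, y, h, by simp, by simp⟩
    | refl x => exact .refl x
    | symm _ ih => exact ih.symm
    | trans _ _ ih₁ ih₂ => exact ih₁.trans _ _ _ ih₂
    | mul _ _ ih₁ ih₂ =>
      exact .trans _ _ _ (by simpa [PeifferEquiv] using hmul 1 _ ih₁)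
        (by simpa [PeifferEquiv] using hmul _ 1 ih₂)

/-- The monoid of `Y`-sequences modulo Peiffer equivalence, i.e. the group underlying the free
crossed module of the presentation. -/
abbrev PeifferGroup (w : L → FreeGroup X) := (conGen (Rule w)).Quotient

/-- The class of a `Y`-sequence in the Peiffer group. -/
def mk (w : L → FreeGroup X) : YSeq X L →* PeifferGroup w := (conGen (Rule w)).mk'

theorem mk_surjective (w : L → FreeGroup X) : Function.Surjective (mk w) := Con.mk'_surjective

theorem mk_eq_mk {w : L → FreeGroup X} {a b : YSeq X L} :
    mk w a = mk w b ↔ PeifferEquiv w a b :=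
  ((conGen (Rule w)).eq).trans peifferEquiv_iff_conGen.symm

theorem mk_eq_of_rule {w : L → FreeGroup X} {a b : YSeq X L} (h : Rule w a b) :
    mk w a = mk w b :=
  ((conGen (Rule w)).eq).2 (.of _ _ h)

theorem mk_neg_mul_pos (w : L → FreeGroup X) (y : Y X L) :
    mk w (letter y (-1)) * mk w (letter y 1) = 1 := by
  rw [← map_mul, mk_eq_of_rule (.neg_pos y), map_one]

theorem mk_pos_mul_neg (w : L → FreeGroup X) (y : Y X L) :
    mk w (letter y 1) * mk w (letter y (-1)) = 1 := by
  rw [← map_mul, mk_eq_of_rule (.pos_neg y), map_one]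

@[elab_as_elim]
theorem YSeq.induction {p : YSeq X L → Prop} (a : YSeq X L) (one : p 1)
    (pos_mul : ∀ y a, p a → p (letter y 1 * a)) (neg_mul : ∀ y a, p a → p (letter y (-1) * a)) :
    p a := by
  induction a using FreeMonoid.inductionOn' with
  | one => exact one
  | of_mul t a ih =>
    obtain ⟨y, ε⟩ := t
    obtain rfl | rfl := Int.units_eq_one_or ε
    exacts [pos_mul y a ih, neg_mul y a ih]

theorem isUnit_peifferGroup (w : L → FreeGroup X) (h : PeifferGroup w) : IsUnit h := by
  obtain ⟨a, rfl⟩ := mk_surjective w h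
  induction a using YSeq.induction with
  | one => simp
  | pos_mul y a ih =>
    rw [map_mul]
    exact (IsUnit.mul ⟨⟨_, _, mk_pos_mul_neg w y, mk_neg_mul_pos w y⟩, rfl⟩ ih)
  | neg_mul y a ih =>
    rw [map_mul]
    exact (IsUnit.mul ⟨⟨_, _, mk_neg_mul_pos w y, mk_pos_mul_neg w y⟩, rfl⟩ ih)

noncomputable instance (w : L → FreeGroup X) : Group (PeifferGroup w) :=
  groupOfIsUnit (isUnit_peifferGroup w)

theorem mk_neg (w : L → FreeGroup X) (y : Y X L) :
    mk w (letter y (-1)) = (mk w (letter y 1))⁻¹ :=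
  eq_inv_of_mul_eq_one_left (mk_neg_mul_pos w y)

/-! ### The boundary map and the Peiffer identity -/

theorem delta_letter (w : L → FreeGroup X) (y : Y X L) (ε : ℤˣ) :
    delta w (letter y ε) = y.2⁻¹ * w y.1 ^ (ε : ℤ) * y.2 :=
  FreeMonoid.lift_eval_of _ _

theorem delta_neg (w : L → FreeGroup X) (y : Y X L) :
    delta w (letter y (-1)) = (delta w (letter y 1))⁻¹ := by
  simp [delta_letter, mul_assoc]

theorem act_letter (x : FreeGroup X) (y : Y X L) (ε : ℤˣ) :
    act x (letter y ε) = letter (y.1, y.2 * x) ε := rfl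

theorem delta_act (w : L → FreeGroup X) (x : FreeGroup X) (y : Y X L) (ε : ℤˣ) :
    delta w (act x (letter y ε)) = x⁻¹ * delta w (letter y ε) * x := by
  simp [act_letter, delta_letter, mul_assoc]

theorem delta_eq_of_rule {w : L → FreeGroup X} {a b : YSeq X L} (h : Rule w a b) :
    delta w a = delta w b := by
  cases h with
  | conj_pos y z => simp [delta_act, delta_neg]
  | conj_neg y z => simp [delta_act, delta_neg]
  | neg_pos y => simp [delta_neg]
  | pos_neg y => simp [delta_neg]

/-- The boundary map of the free crossed module, induced by `delta`. -/
def boundary (w : L → FreeGroup X) : PeifferGroup w →* FreeGroup X :=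
  (conGen (Rule w)).lift (delta w) (Con.conGen_le.2 fun _ _ h => delta_eq_of_rule h)

@[simp]
theorem boundary_mk (w : L → FreeGroup X) (a : YSeq X L) : boundary w (mk w a) = delta w a := rfl

/-- The Peiffer identity: conjugating a generator by the class of `a` translates it by `δ a`. -/
theorem conj_mk_letter (w : L → FreeGroup X) (a : YSeq X L) (r : L) (u : FreeGroup X) :
    (mk w a)⁻¹ * mk w (letter (r, u) 1) * mk w a = mk w (letter (r, u * delta w a) 1) := by
  induction a using YSeq.induction generalizing u with
  | one => simp
  | pos_mul y a ih =>
    have h := mk_eq_of_rule (Rule.conj_pos (w := w) y (r, u))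
    rw [act_letter, map_mul, map_mul, mk_neg] at h
    rw [map_mul, map_mul, ← mul_assoc u, ← ih, ← h]
    group
  | neg_mul y a ih =>
    have h := mk_eq_of_rule (Rule.conj_neg (w := w) y (r, u))
    rw [act_letter, map_mul, map_mul, mk_neg, mk_neg, mk_neg] at h
    rw [map_mul, map_mul, ← mul_assoc u, ← ih, inv_eq_iff_eq_inv.1 h.symm, mk_neg]
    group

theorem ker_boundary_le_center (w : L → FreeGroup X) :
    (boundary w).ker ≤ Subgroup.center (PeifferGroup w) := by
  intro k hk
  obtain ⟨a, rfl⟩ := mk_surjective w k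
  have ha : delta w a = 1 := hk
  have hpos : ∀ y, Commute (mk w (letter y 1)) (mk w a) := fun y => by
    have h := conj_mk_letter w a y.1 y.2
    rw [ha, mul_one, mul_assoc, inv_mul_eq_iff_eq_mul] at h
    exact h
  refine Subgroup.mem_center_iff.2 fun h => ?_
  obtain ⟨b, rfl⟩ := mk_surjective w h
  change Commute _ _
  induction b using YSeq.induction with
  | one => simp
  | pos_mul y b ih => rw [map_mul]; exact (hpos y).mul_left ih
  | neg_mul y b ih => rw [map_mul, mk_neg]; exact (hpos y).inv_left.mul_left ih

theorem normalClosure_le_range_boundary (w : L → FreeGroup X) :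
    Subgroup.normalClosure (Set.range w) ≤ (boundary w).range := by
  have : (boundary w).range.Normal := by
    constructor
    rintro _ ⟨h, rfl⟩ x
    obtain ⟨a, rfl⟩ := mk_surjective w h
    induction a using YSeq.induction with
    | one => simp
    | pos_mul y a ih =>
      have hy : x * delta w (letter y 1) * x⁻¹ ∈ (boundary w).range :=
        ⟨mk w (act x⁻¹ (letter y 1)), by simp [delta_act]⟩
      simpa [mul_assoc] using mul_mem hy ih
    | neg_mul y a ih =>
      have hy : x * delta w (letter y (-1)) * x⁻¹ ∈ (boundary w).range :=
        ⟨mk w (act x⁻¹ (letter y (-1))), by simp [delta_act]⟩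
      simpa [mul_assoc] using mul_mem hy ih
  refine Subgroup.normalClosure_le_normal ?_
  rintro _ ⟨r, rfl⟩
  exact ⟨mk w (letter (r, 1) 1), by simp [delta_letter]⟩

theorem delta_mem_normalClosure (w : L → FreeGroup X) (a : YSeq X L) :
    delta w a ∈ Subgroup.normalClosure (Set.range w) := by
  induction a using FreeMonoid.inductionOn' with
  | one => simp
  | of_mul t a ih =>
    rw [map_mul]
    refine mul_mem ?_ ih
    have h := Subgroup.normalClosure_normal.conj_mem (w t.1.1 ^ (t.2 : ℤ))
      (zpow_mem (Subgroup.subset_normalClosure (Set.mem_range_self t.1.1)) _) t.1.2⁻¹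
    simpa [delta] using h

/-! ### Invariance of `alpha` under Peiffer equivalence -/

@[simp]
theorem alpha_one (θ : FreeGroup X →* G) : alpha θ (1 : YSeq X L) = 0 := rfl

@[simp]
theorem alpha_mul (θ : FreeGroup X →* G) (a b : YSeq X L) :
    alpha θ (a * b) = alpha θ a + alpha θ b := by
  simp [alpha]

theorem alpha_letter (θ : FreeGroup X →* G) (y : Y X L) (ε : ℤˣ) :
    alpha θ (letter y ε) =
      Finsupp.single y.1 (MonoidAlgebra.single (θ y.2) (ε : ℤ)) := by
  simp [alpha, letter]

theorem alpha_neg (θ : FreeGroup X →* G) (y : Y X L) :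
    alpha θ (letter y (-1)) = -alpha θ (letter y 1) := by
  simp [alpha_letter, MonoidAlgebra.single_neg]

theorem alpha_act {θ : FreeGroup X →* G} {x : FreeGroup X} (hx : θ x = 1) (y : Y X L) (ε : ℤˣ) :
    alpha θ (act x (letter y ε)) = alpha θ (letter y ε) := by
  simp [act_letter, alpha_letter, hx]

theorem alpha_eq_of_rule {w : L → FreeGroup X} {θ : FreeGroup X →* G}
    (hker : θ.ker = Subgroup.normalClosure (Set.range w)) {a b : YSeq X L} (h : Rule w a b) :
    alpha θ a = alpha θ b := by
  have hδ : ∀ c : YSeq X L, θ (delta w c) = 1 := fun c =>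
    MonoidHom.mem_ker.1 (hker ▸ delta_mem_normalClosure w c)
  cases h with
  | conj_pos y z => simp [alpha_act (hδ _), alpha_neg]
  | conj_neg y z => simp [alpha_act (hδ _), alpha_neg]
  | neg_pos y => simp [alpha_neg]
  | pos_neg y => simp [alpha_neg]

theorem PeifferEquiv.alpha_eq {w : L → FreeGroup X} {θ : FreeGroup X →* G}
    (hker : θ.ker = Subgroup.normalClosure (Set.range w)) {a b : YSeq X L}
    (h : PeifferEquiv w a b) : alpha θ a = alpha θ b := by
  induction h with
  | rel x y h =>
    obtain ⟨p, q, l, r, h, rfl, rfl⟩ := h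
    simp [alpha_eq_of_rule hker h]
  | refl x => rfl
  | symm x y _ ih => exact ih.symm
  | trans x y z _ _ ih₁ ih₂ => exact ih₁.trans ih₂

/-! ### The abelianized Peiffer group -/

/-- The additive map from the free `ℤG`-module to the abelianized Peiffer group that sends the basis
element `r g` to the class of `(r, u)`, where `u` is a chosen preimage of `g` under `θ`. -/
noncomputable def toAbelianization (w : L → FreeGroup X) {θ : FreeGroup X →* G}
    (hsurj : Function.Surjective θ) :
    FreeRightMod L G →+ Additive (Abelianization (PeifferGroup w)) :=
  Finsupp.liftAddHom fun r =>
    (Finsupp.liftAddHom fun g => zmultiplesHom _ (Additive.ofMul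
      (Abelianization.of (mk w (letter (r, Function.surjInv hsurj g) 1))))).comp
    (MonoidAlgebra.coeffAddEquiv (R := ℤ) (M := G)).toAddMonoidHom

/-- In the abelianized Peiffer group, the class of `(r, u)` depends on `u` only through `θ u`. -/
theorem abelianization_mk_letter_eq {w : L → FreeGroup X} {θ : FreeGroup X →* G}
    (hker : θ.ker = Subgroup.normalClosure (Set.range w)) (r : L) {u v : FreeGroup X}
    (h : θ u = θ v) :
    Abelianization.of (mk w (letter (r, u) 1)) = Abelianization.of (mk w (letter (r, v) 1)) := by
  have huv : u⁻¹ * v ∈ θ.ker := by simp [MonoidHom.mem_ker, h]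
  rw [hker] at huv
  obtain ⟨k, hk⟩ := normalClosure_le_range_boundary w huv
  obtain ⟨a, rfl⟩ := mk_surjective w k
  have hc := conj_mk_letter w a r u
  rw [boundary_mk] at hk
  rw [hk, mul_inv_cancel_left] at hc
  rw [← hc, map_mul, map_mul, map_inv, mul_right_comm, inv_mul_cancel, one_mul]

theorem toAbelianization_alpha {w : L → FreeGroup X} {θ : FreeGroup X →* G}
    (hsurj : Function.Surjective θ) (hker : θ.ker = Subgroup.normalClosure (Set.range w))
    (a : YSeq X L) :
    toAbelianization w hsurj (alpha θ a) = Additive.ofMul (Abelianization.of (mk w a)) := by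
  have hpos : ∀ y : Y X L, toAbelianization w hsurj (alpha θ (letter y 1)) =
      Additive.ofMul (Abelianization.of (mk w (letter y 1))) := fun y => by
    have := abelianization_mk_letter_eq hker y.1 (Function.surjInv_eq hsurj (θ y.2))
    simp [alpha_letter, toAbelianization, this]
  induction a using YSeq.induction with
  | one => simp
  | pos_mul y a ih => simp [ih, hpos]
  | neg_mul y a ih => simp [ih, hpos, alpha_neg, mk_neg]

/-- Two identity sequences with the same image under `alpha` are Peiffer equivalent. -/
theorem peifferEquiv_of_alpha_eq {w : L → FreeGroup X} {θ : FreeGroup X →* G}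
    (hsurj : Function.Surjective θ) (hker : θ.ker = Subgroup.normalClosure (Set.range w))
    {a b : YSeq X L} (ha : IsIdentitySeq w a) (hb : IsIdentitySeq w b)
    (h : alpha θ a = alpha θ b) : PeifferEquiv w a b := by
  have hab : Abelianization.of (mk w a) = Abelianization.of (mk w b) :=
    Additive.ofMul.injective <| by
      rw [← toAbelianization_alpha hsurj hker, ← toAbelianization_alpha hsurj hker, h]
  have hcomm : mk w a * (mk w b)⁻¹ ∈ commutator (PeifferGroup w) := by
    rw [← Abelianization.ker_of, MonoidHom.mem_ker, map_mul, map_inv, hab, mul_inv_cancel]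
  have hmem : mk w a * (mk w b)⁻¹ ∈ (boundary w).ker := by
    rw [MonoidHom.mem_ker, map_mul, map_inv, boundary_mk, boundary_mk, ha, hb, inv_one, mul_one]
  have hbot := (boundary w).ker_inf_commutator_eq_bot (ker_boundary_le_center w)
  rw [← mk_eq_mk, ← mul_inv_eq_one, ← Subgroup.mem_bot, ← hbot]
  exact ⟨hmem, hcomm⟩

end PeifferSeq

theorem lemma5p6p2 {X L G : Type*} [Group G] (w : L → FreeGroup X) (θ : FreeGroup X →* G)
    (hsurj : Function.Surjective θ)
    (hker : θ.ker = Subgroup.normalClosure (Set.range w)) :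
    (∀ a : PeifferSeq.YSeq X L, PeifferSeq.IsIdentitySeq w a →
      (PeifferSeq.PeifferEquiv w a 1 ↔ PeifferSeq.alpha θ a = 0)) ∧
    (∀ a b : PeifferSeq.YSeq X L,
      PeifferSeq.IsIdentitySeq w a → PeifferSeq.IsIdentitySeq w b →
      (PeifferSeq.PeifferEquiv w a b ↔ PeifferSeq.alpha θ a = PeifferSeq.alpha θ b) ∧
      (PeifferSeq.PeifferEquiv w a b ↔
        PeifferSeq.cyclicSub (PeifferSeq.alpha θ a - PeifferSeq.alpha θ b) =
          PeifferSeq.cyclicSub 0) ∧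
      (PeifferSeq.PeifferEquiv w a b →
        PeifferSeq.cyclicSub (PeifferSeq.alpha θ a) =
          PeifferSeq.cyclicSub (PeifferSeq.alpha θ b))) := by
  have key : ∀ a b : PeifferSeq.YSeq X L,
      PeifferSeq.IsIdentitySeq w a → PeifferSeq.IsIdentitySeq w b →
      (PeifferSeq.PeifferEquiv w a b ↔ PeifferSeq.alpha θ a = PeifferSeq.alpha θ b) :=
    fun a b ha hb => ⟨fun h => h.alpha_eq hker,
      PeifferSeq.peifferEquiv_of_alpha_eq hsurj hker ha hb⟩
  refine ⟨fun a ha => key a 1 ha (map_one _), fun a b ha hb => ⟨key a b ha hb, ?_, fun h => ?_⟩⟩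
  · rw [key a b ha hb, PeifferSeq.cyclicSub, PeifferSeq.cyclicSub, Submodule.span_zero_singleton,
      Submodule.span_singleton_eq_bot, sub_eq_zero]
  · rw [h.alpha_eq hker]
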